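/- Graphs are finite, undirected, without loops or parallel edges. An involution of a graph is an automorphism $\rho\neq\mathrm{id}$ with $\rho\circ\rho=\mathrm{id}$; a graph is involution-free if it has no involution. Fix a graph $H$. A partially $H$-labelled graph is a pair $J=(G,\tau)$ consisting of a graph $G$ and a partial function $\tau$ from $V(G)$ to $V(H)$; a homomorphism from $J$ to $H$ is a graph homomorphism $\sigma\colon G\to H$ with $\sigma(v)=\tau(v)$ for every $v\in\mathrm{dom}(\tau)$. Let $\oplus\mathrm{PartLabHomsTo}H$ be the problem of computing, given a partially $H$-labelled graph $J$, the number of homomorphisms from $J$ to $H$ modulo $2$, and let $\oplus\mathrm{HomsTo}H$ be the problem of computing, given a graph $G$, the number of homomorphisms from $G$ to $H$ modulo $2$. **Theorem.** For every involution-free graph $H$, the problem $\oplus\mathrm{PartLabHomsTo}H$ is polynomial-time Turing-reducible to $\oplus\mathrm{HomsTo}H$; that is, there is a deterministic oracle Turing machine (depending on $H$) that, given any oracle for $\oplus\mathrm{HomsTo}H$, solves $\oplus\mathrm{PartLabHomsTo}H$ in time polynomial in the length of the input. (Graphs are encoded by adjacency matrices and pinning functions by tables of values.) -/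

import Mathlib

namespace ParityHom

/-! ### Graphs, involutions, partially labelled graphs -/

/-- An involution of a graph: an automorphism that is not the identity and whose square is the
identity. -/
def IsInvolution {V : Type} {H : SimpleGraph V} (ρ : H ≃g H) : Prop :=
  ρ ≠ SimpleGraph.Iso.refl ∧ ρ.trans ρ = SimpleGraph.Iso.refl

/-- A graph is involution-free if none of its automorphisms is an involution. -/
def InvolutionFree {V : Type} (H : SimpleGraph V) : Prop :=
  ∀ ρ : H ≃g H, ¬ IsInvolution ρ

/-- A finite graph given as an input; its vertices are numbered `0, …, n - 1`. -/
structure InputGraph where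
  n : ℕ
  graph : SimpleGraph (Fin n)

/-- A partially `H`-labelled graph (with `V = V(H)`) given as an input: an underlying graph together
with a pinning function, a partial function from its vertices to `V`. -/
structure PartLabGraph (V : Type) extends InputGraph where
  pin : Fin n → Option V

/-- The homomorphisms from a partially `H`-labelled graph to `H`: the homomorphisms from the
underlying graph to `H` that respect the pinning function. -/
def PartLabGraph.Homs {V : Type} (J : PartLabGraph V) (H : SimpleGraph V) : Type :=
  {f : J.graph →g H // ∀ v y, J.pin v = some y → f v = y}

/-! ### Encodings of inputs by strings -/

open Classical in
/-- The adjacency matrix of a graph, written row by row; `some b` is an entry and `none` marks the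
end of a row. -/
noncomputable def InputGraph.encode (G : InputGraph) : List (Option Bool) :=
  (List.finRange G.n).flatMap fun u =>
    ((List.finRange G.n).map fun v => some (decide (G.graph.Adj u v))) ++ [none]

/-- The table of values of the pinning function, followed by the adjacency matrix of the underlying
graph. -/
noncomputable def PartLabGraph.encode {V : Type} (J : PartLabGraph V) :
    List (Option V ⊕ Option Bool) :=
  ((List.finRange J.n).map fun v => Sum.inl (J.pin v)) ++ J.toInputGraph.encode.map Sum.inr

theorem InputGraph.encode_injective : Function.Injective InputGraph.encode := by
  classical
  rintro ⟨n, G⟩ ⟨m, G'⟩ h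
  have hlen := congrArg List.length h
  simp only [InputGraph.encode, List.length_flatMap, List.length_append, List.length_map,
    List.length_finRange, List.length_singleton, List.map_const', List.sum_replicate,
    smul_eq_mul] at hlen
  have hnm : n = m := by
    rcases lt_trichotomy n m with h' | h' | h'
    · nlinarith
    · exact h'
    · nlinarith
  subst hnm
  have h2 : (List.finRange n).map (fun u =>
        ((List.finRange n).map fun v => some (decide (G.Adj u v))) ++ [none])
      = (List.finRange n).map (fun u =>
        ((List.finRange n).map fun v => some (decide (G'.Adj u v))) ++ [none]) := by
    rw [List.eq_iff_flatten_eq]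
    refine ⟨?_, by simp [Function.comp_def]⟩
    simpa [InputGraph.encode, List.flatMap] using h
  have h3 : G = G' := by
    ext u v
    have h4 := List.map_inj_left.1 h2 u (List.mem_finRange u)
    have h5 := List.map_inj_left.1 (List.append_cancel_right h4) v (List.mem_finRange v)
    simpa using h5
  rw [h3]

theorem PartLabGraph.encode_injective {V : Type} :
    Function.Injective (PartLabGraph.encode (V := V)) := by
  rintro ⟨⟨n, G⟩, τ⟩ ⟨⟨m, G'⟩, τ'⟩ h
  have hr := congrArg (List.filterMap (Sum.elim (fun _ => none) some)) h
  have hl := congrArg (List.filterMap (Sum.elim some (fun _ => none))) h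
  simp only [PartLabGraph.encode, List.filterMap_append, List.filterMap_map, Function.comp_def,
    Sum.elim_inl, Sum.elim_inr, List.filterMap_none, List.nil_append, List.append_nil,
    List.filterMap_some] at hr hl
  have hG := InputGraph.encode_injective hr
  cases hG
  have : τ = τ' := by
    funext v
    have hl' : (List.finRange n).map τ = (List.finRange n).map τ' := by
      simpa [List.filterMap_eq_map'] using hl
    exact List.map_inj_left.1 hl' v (List.mem_finRange v)
  rw [this]

/-! ### Computational problems with values modulo 2 -/

/-- A computational problem: given an instance, encoded as a string over a finite alphabet, compute
a value in `ZMod 2`. -/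
structure ParityProblem where
  Inst : Type
  Sym : Type
  finite_sym : Finite Sym
  encode : Inst → List Sym
  encode_injective : Function.Injective encode
  value : Inst → ZMod 2

/-- `⊕HomsToH`: given a graph `G`, compute the number of homomorphisms from `G` to `H` modulo 2. -/
noncomputable def homsTo {V : Type} (H : SimpleGraph V) : ParityProblem where
  Inst := InputGraph
  Sym := Option Bool
  finite_sym := inferInstance
  encode := InputGraph.encode
  encode_injective := InputGraph.encode_injective
  value := fun G => (Nat.card (G.graph →g H) : ZMod 2)

/-- `⊕PartLabHomsToH`: given a partially `H`-labelled graph `J`, compute the number of homomorphisms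
from `J` to `H` modulo 2. -/
noncomputable def partLabHomsTo {V : Type} [Finite V] (H : SimpleGraph V) : ParityProblem where
  Inst := PartLabGraph V
  Sym := Option V ⊕ Option Bool
  finite_sym := inferInstance
  encode := PartLabGraph.encode
  encode_injective := PartLabGraph.encode_injective
  value := fun J => (Nat.card (J.Homs H) : ZMod 2)

/-! ### Oracle Turing machines and polynomial-time Turing reductions -/

/-- What an oracle machine does at a label: run a statement of Mathlib's multi-stack Turing machine
model, or ask the oracle, record the answer in the internal state and jump to a label. -/
inductive OracleInstr {K : Type} (Γ : K → Type) (Λ σ : Type) : Type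
  | run : Turing.TM2.Stmt Γ Λ σ → OracleInstr Γ Λ σ
  | ask : (σ → ZMod 2 → σ) → Λ → OracleInstr Γ Λ σ

/-- A deterministic oracle Turing machine, with input alphabet `A` and oracle-query alphabet `B`:
a multi-stack Turing machine with finitely many stacks, stack symbols, labels and internal states,
one of whose stacks serves as the query tape. The input is written on the stack `input`, symbol by
symbol, through `inSym`; the contents of the stack `query` are read as a string over `B` through
`querySym`; the one-symbol output is a function of the internal state in which the machine halts. -/
structure OracleTM (A B : Type) where
  K : Type
  [decEqK : DecidableEq K]
  [finiteK : Finite K]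
  Γ : K → Type
  [finiteΓ : ∀ k, Finite (Γ k)]
  Λ : Type
  [finiteΛ : Finite Λ]
  σ : Type
  [finiteσ : Finite σ]
  input : K
  inSym : A → Γ input
  query : K
  querySym : Γ query → B
  main : Λ
  initialState : σ
  prog : Λ → OracleInstr Γ Λ σ
  out : σ → ZMod 2

namespace OracleTM

variable {A B : Type} (M : OracleTM A B)

instance : DecidableEq M.K := M.decEqK

/-- Configurations: current label (`none` when halted), internal state, stacks. -/
abbrev Cfg : Type := Turing.TM2.Cfg M.Γ M.Λ M.σ

/-- The initial configuration on input `w` (whose first symbol is on top of the input stack). -/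
def init (w : List A) : M.Cfg where
  l := some M.main
  var := M.initialState
  stk := Function.update (fun _ => []) M.input (w.map M.inSym)

/-- One step with oracle `O`. A query is a single step; it empties the query stack. -/
def step (O : List B → ZMod 2) : M.Cfg → Option M.Cfg
  | ⟨none, _, _⟩ => none
  | ⟨some l, v, S⟩ =>
    match M.prog l with
    | .run q => some (Turing.TM2.stepAux q v S)
    | .ask f l' =>
      some ⟨some l', f v (O ((S M.query).map M.querySym)), Function.update S M.query []⟩

/-- With oracle `O`, on input `w`, the machine halts after at most `t` steps with output `b`. -/
def OutputsWithin (O : List B → ZMod 2) (w : List A) (b : ZMod 2) (t : ℕ) : Prop :=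
  ∃ c : M.Cfg, c.l = none ∧ M.out c.var = b ∧
    Nonempty (StateTransition.EvalsToInTime (M.step O) (M.init w) (some c) t)

end OracleTM

/-- `O` is an oracle for `Q`: it answers every string that encodes an instance of `Q` with the value
of that instance (and all other strings arbitrarily). -/
def ParityProblem.IsOracle (Q : ParityProblem) (O : List Q.Sym → ZMod 2) : Prop :=
  ∀ y : Q.Inst, O (Q.encode y) = Q.value y

/-- Polynomial-time Turing reducibility `P ≤ Q`: some oracle Turing machine, given any oracle for
`Q`, solves `P` in time polynomial in the length of the input. -/
def PolyTimeTuringReducible (P Q : ParityProblem) : Prop :=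
  ∃ (M : OracleTM P.Sym Q.Sym) (p : Polynomial ℕ),
    ∀ O : List Q.Sym → ZMod 2, Q.IsOracle O →
      ∀ x : P.Inst, M.OutputsWithin O (P.encode x) (P.value x) (p.eval (P.encode x).length)

end ParityHom

namespace ParityHom

open Classical

/-! ### Automorphisms of involution-free graphs -/

/-! Write `G` for the underlying graph of `J` and count pairs `(σ, φ)` of a homomorphism `σ : G → H`
and an automorphism `φ` of `H` such that `σ u = φ y` whenever `u` is pinned to `y`. Sending such a
pair to `(φ, φ⁻¹ ∘ σ)` shows that there are `|Aut H|` times as many of them as homomorphisms from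
`J` to `H` (`injPairEquiv`). By Cauchy's theorem `|Aut H|` is odd when `H` has no involution, so
modulo 2 it suffices to count these pairs.

Automorphisms of a finite graph are its injective endomorphisms. Modulo 2, injectivity of `φ` is the
product over ordered pairs `a ≠ b` of `1 + [φ a = φ b]`, since a collision gives a factor `1 + 1 =
0`. Expanding the product gives a sum over sets `S` of pairs of the indicator that `φ` identifies
every pair in `S` (`sum_retraction_eq_injective`). For fixed `S`, the pairs `(σ, φ)`, with `φ` now
an arbitrary endomorphism, are the homomorphisms to `H` from the quotient of `G ⊔ H` that glues each
pinned vertex to its label and merges labels along `S` (`quotHomsEquiv`). If the quotient has a loop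
there are none; otherwise one oracle answer gives their parity. The number of sets `S` depends only
on `H`, and each quotient has at most `n + |V(H)|` vertices.

The machine builds all the query strings in one pass over the matrix. Adjacencies among labels fit
in the finite internal state. For each `S`, one stack collects the rows of the unlabelled vertices
and one stack per label class collects the row of that class; the entries of a class row in
unlabelled columns are obtained from the rows of the unlabelled vertices by symmetry
(`finalOut_concat`). -/

theorem InvolutionFree.odd_card_aut {V : Type} [Finite V] {H : SimpleGraph V}
    (hH : InvolutionFree H) : Odd (Nat.card (H ≃g H)) := by
  have : Finite (H ≃g H) := DFunLike.finite _
  rw [← Nat.not_even_iff_odd, even_iff_two_dvd]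
  intro h2
  have : Fact (Nat.Prime 2) := ⟨Nat.prime_two⟩
  -- Cauchy's theorem; an element of order 2 is an involution.
  obtain ⟨ρ, hρ⟩ := exists_prime_orderOf_dvd_card' (G := H ≃g H) 2 h2
  refine hH ρ ⟨fun h => ?_, ?_⟩
  · have h1 : ρ = 1 := h
    rw [h1, orderOf_one] at hρ
    omega
  · have h1 : ρ ^ 2 = 1 := hρ ▸ pow_orderOf_eq_one ρ
    rwa [pow_two] at h1

/-- An injective endomorphism of a finite graph is an automorphism. -/
noncomputable def autOfInjective {V : Type} [Finite V] {H : SimpleGraph V} (φ : H →g H)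
    (hφ : Function.Injective φ) : H ≃g H where
  toEquiv := Equiv.ofBijective φ hφ.bijective_of_finite
  map_rel_iff' := by
    intro a b
    refine ⟨fun h => ?_, fun h => φ.map_adj h⟩
    -- `φ` acts injectively on the finite set of adjacent ordered pairs, hence surjectively, so
    -- adjacency is also reflected.
    let ψ : {p : V × V // H.Adj p.1 p.2} → {p : V × V // H.Adj p.1 p.2} :=
      fun p => ⟨(φ p.1.1, φ p.1.2), φ.map_adj p.2⟩
    have hψ : Function.Injective ψ := by
      rintro ⟨⟨a, b⟩, h⟩ ⟨⟨c, d⟩, h'⟩ e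
      simp only [ψ, Subtype.mk.injEq, Prod.mk.injEq] at e ⊢
      exact ⟨hφ e.1, hφ e.2⟩
    obtain ⟨⟨⟨c, d⟩, hc⟩, e⟩ := hψ.bijective_of_finite.2 ⟨(φ a, φ b), h⟩
    have e' : (φ c, φ d) = (φ a, φ b) := congrArg Subtype.val e
    rw [Prod.mk.injEq] at e'
    rwa [← hφ e'.1, ← hφ e'.2]

@[simp] theorem autOfInjective_apply {V : Type} [Finite V] {H : SimpleGraph V} (φ : H →g H)
    (hφ : Function.Injective φ) (x : V) : autOfInjective φ hφ x = φ x := rfl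

/-! ### Injectivity as a sum over retractions, modulo 2 -/

/-- A choice of representatives for the equivalence relation generated by a set of pairs. -/
noncomputable def retraction {V : Type} (S : Finset (V × V)) (x : V) : V :=
  Quot.out (Quot.mk (fun a b => (a, b) ∈ S) x)

theorem retraction_idem {V : Type} (S : Finset (V × V)) (x : V) :
    retraction S (retraction S x) = retraction S x := by
  simp [retraction]

/-- Both sides say that `φ` factors through the quotient generated by `S`: `Quot.lift` supplies the
factorisation, and `retraction S` picks representatives of its classes. -/
theorem comp_retraction_iff {V W : Type} (S : Finset (V × V)) (φ : V → W) :
    (∀ x, φ (retraction S x) = φ x) ↔ ∀ p ∈ S, φ p.1 = φ p.2 := by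
  constructor
  · intro h p hp
    have : retraction S p.1 = retraction S p.2 :=
      congrArg Quot.out (Quot.sound (r := fun a b => (a, b) ∈ S) hp)
    rw [← h p.1, this, h]
  · intro h x
    let ψ : Quot (fun a b => (a, b) ∈ S) → W := Quot.lift φ fun a b hab => h (a, b) hab
    have : ∀ q, φ (Quot.out q) = ψ q := fun q => by
      conv_rhs => rw [← Quot.out_eq q]
    exact this _

theorem sum_retraction_eq_injective {V : Type} [Fintype V] (φ : V → V) :
    ∑ S ∈ (Finset.univ : Finset V).offDiag.powerset,
      (if ∀ x, φ (retraction S x) = φ x then 1 else 0 : ZMod 2) =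
      if Function.Injective φ then 1 else 0 := by
  have h1 : ∀ S : Finset (V × V), (if ∀ x, φ (retraction S x) = φ x then 1 else 0 : ZMod 2) =
      ∏ p ∈ S, if φ p.1 = φ p.2 then 1 else 0 := by
    intro S
    rw [Finset.prod_ite_zero]
    simp [comp_retraction_iff]
  simp only [h1]
  -- The sum over all subsets is the expansion of a product over pairs of distinct elements.
  rw [← Finset.prod_one_add]
  split_ifs with h
  · refine Finset.prod_eq_one fun p hp => ?_
    simp only [Finset.mem_offDiag] at hp
    rw [if_neg (fun e => hp.2.2 (h e)), add_zero]
  · simp only [Function.Injective, not_forall] at h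
    obtain ⟨a, b, e, hab⟩ := h
    refine Finset.prod_eq_zero (i := (a, b)) (by simpa using hab) ?_
    rw [if_pos e]
    -- `1 + 1 = 0` in `ZMod 2`.
    rfl

/-! ### The query graphs -/

section Query

variable {V : Type} (J : PartLabGraph V) (H : SimpleGraph V) (r : V → V)

/-- The identification of a pinned vertex with its label, and of a label with its representative. -/
def PartLabGraph.identify : Fin J.n ⊕ V → Fin J.n ⊕ V
  | .inl u => (J.pin u).elim (.inl u) fun y => .inr (r y)
  | .inr x => .inr (r x)

/-- Adjacency in the quotient of the disjoint union of `J` and `H`. -/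
def PartLabGraph.QuotAdj (a b : Fin J.n ⊕ V) : Prop :=
  ∃ x y, J.identify r x = a ∧ J.identify r y = b ∧ (J.graph ⊕g H).Adj x y

/-- The vertices without a label. -/
noncomputable def PartLabGraph.free : List (Fin J.n) :=
  (List.finRange J.n).filter fun u => J.pin u = none

/-- The fixed points of `r`. -/
noncomputable def fixedList [Fintype V] : List V :=
  (Finset.univ : Finset V).toList.filter fun x => r x = x

theorem mem_fixedList [Fintype V] {x : V} : x ∈ fixedList r ↔ r x = x := by
  simp [fixedList]

/-- The vertices of the quotient. -/
noncomputable def PartLabGraph.quotVerts [Fintype V] : List (Fin J.n ⊕ V) :=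
  J.free.map Sum.inl ++ (fixedList r).map Sum.inr

/-- The adjacency matrix of the quotient, written row by row. -/
noncomputable def PartLabGraph.quotEncode [Fintype V] : List (Option Bool) :=
  (J.quotVerts r).flatMap fun a =>
    ((J.quotVerts r).map fun b => some (decide (J.QuotAdj H r a b))) ++ [none]

/-- Pairs of a homomorphism from the underlying graph of `J` and an endomorphism of `H` that are
compatible with the identifications. -/
def PartLabGraph.CompatPair (p : (J.graph →g H) × (H →g H)) : Prop :=
  (∀ u y, J.pin u = some y → p.1 u = p.2 y) ∧ ∀ x, p.2 (r x) = p.2 x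

variable {J H r}

theorem PartLabGraph.QuotAdj.symm {a b : Fin J.n ⊕ V} (h : J.QuotAdj H r a b) :
    J.QuotAdj H r b a := by
  obtain ⟨a', b', ha, hb, h⟩ := h
  exact ⟨b', a', hb, ha, h.symm⟩

theorem PartLabGraph.identify_idem (hr : ∀ x, r (r x) = r x) (a : Fin J.n ⊕ V) :
    J.identify r (J.identify r a) = J.identify r a := by
  rcases a with u | x
  · rcases h : J.pin u with _ | y <;> simp [identify, h, hr]
  · simp [identify, hr]

/-- Together with `identify_idem`, this makes the list a system of representatives for the classes,
so the quotient needs no quotient type. -/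
theorem PartLabGraph.mem_quotVerts [Fintype V] {a : Fin J.n ⊕ V} :
    a ∈ J.quotVerts r ↔ J.identify r a = a := by
  rcases a with u | x
  · rcases h : J.pin u with _ | y <;>
      simp [quotVerts, free, identify, h]
  · simp [quotVerts, identify, mem_fixedList]

theorem PartLabGraph.nodup_quotVerts [Fintype V] : (J.quotVerts r).Nodup := by
  refine List.Nodup.append ?_ ?_ ?_
  · exact ((List.nodup_finRange _).filter _).map Sum.inl_injective
  · exact ((Finset.nodup_toList _).filter _).map Sum.inr_injective
  · intro a ha hb
    simp only [List.mem_map] at ha hb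
    obtain ⟨x, -, rfl⟩ := ha
    obtain ⟨y, -, h⟩ := hb
    cases h

/-- Compatibility in terms of the induced map on the disjoint union. -/
theorem PartLabGraph.compatPair_iff {p : (J.graph →g H) × (H →g H)} :
    J.CompatPair H r p ↔
      ∀ a, Sum.elim p.1 p.2 (J.identify r a) = Sum.elim p.1 p.2 a := by
  constructor
  · rintro ⟨h1, h2⟩ (u | x)
    · rcases h : J.pin u with _ | y
      · simp [identify, h]
      · simp [identify, h, h2, h1 u y h]
    · simp [identify, h2]
  · intro h
    have h2 : ∀ x, p.2 (r x) = p.2 x := fun x => by simpa [identify] using h (.inr x)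
    refine ⟨fun u y hu => ?_, h2⟩
    have := h (.inl u)
    simp only [identify, hu, Option.elim_some, Sum.elim_inr, Sum.elim_inl] at this
    rw [← this, h2]

theorem PartLabGraph.elim_adj (p : (J.graph →g H) × (H →g H)) {a b : Fin J.n ⊕ V}
    (h : (J.graph ⊕g H).Adj a b) : H.Adj (Sum.elim p.1 p.2 a) (Sum.elim p.1 p.2 b) := by
  rcases a with a | a <;> rcases b with b | b <;> simp at h ⊢
  · exact p.1.map_adj h
  · exact p.2.map_adj h

/-- An edge of the quotient comes from an edge of the disjoint union, and a compatible pair takes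
the same values at a vertex and at its representative. -/
theorem PartLabGraph.CompatPair.adj_of_quotAdj {p : (J.graph →g H) × (H →g H)}
    (hp : J.CompatPair H r p) {a b : Fin J.n ⊕ V} (h : J.QuotAdj H r a b) :
    H.Adj (Sum.elim p.1 p.2 a) (Sum.elim p.1 p.2 b) := by
  obtain ⟨a', b', rfl, rfl, h⟩ := h
  rw [compatPair_iff] at hp
  rw [hp, hp]
  exact elim_adj p h

/-- The quotient graph, when it has no loops. -/
noncomputable def PartLabGraph.quotGraph [Fintype V] (J : PartLabGraph V) (H : SimpleGraph V)
    (r : V → V) (h : ∀ a, ¬ J.QuotAdj H r a a) : InputGraph where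
  n := (J.quotVerts r).length
  graph :=
    { Adj := fun i j => J.QuotAdj H r ((J.quotVerts r).get i) ((J.quotVerts r).get j)
      symm := ⟨fun _ _ h => h.symm⟩
      loopless := ⟨fun _ => h _⟩ }

/-- The string `quotEncode` is defined even when the quotient has loops, which is what the machine
needs, as it writes the string in every case. Without loops it is a genuine instance of the oracle
problem. -/
theorem PartLabGraph.encode_quotGraph [Fintype V] (h : ∀ a, ¬ J.QuotAdj H r a a) :
    (J.quotGraph H r h).encode = J.quotEncode H r := by
  have e : ∀ (l : List (Fin J.n ⊕ V)) (f : Fin J.n ⊕ V → Option Bool),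
      (List.finRange l.length).map (fun i => f (l.get i)) = l.map f := by
    intro l f
    conv_rhs => rw [← List.map_get_finRange l, List.map_map]
    rfl
  have e' : ∀ (l : List (Fin J.n ⊕ V)) (f : Fin J.n ⊕ V → List (Option Bool)),
      (List.finRange l.length).flatMap (fun i => f (l.get i)) = l.flatMap f := by
    intro l f
    conv_rhs => rw [← List.map_get_finRange l, List.flatMap_map]
  rw [quotEncode, ← e']
  simp only [← e]
  rfl

/-- Homomorphisms from the quotient graph are the compatible pairs of homomorphisms. -/
noncomputable def PartLabGraph.quotHomsEquiv [Fintype V] (hr : ∀ x, r (r x) = r x)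
    (h : ∀ a, ¬ J.QuotAdj H r a a) :
    ((J.quotGraph H r h).graph →g H) ≃ {p // J.CompatPair H r p} := by
  let L := J.quotVerts r
  have hL : ∀ a, J.identify r a ∈ L := fun a => mem_quotVerts.2 (identify_idem hr a)
  -- `ix a` is the position in the list of the representative of `a`.
  choose ix hix using fun a => List.mem_iff_get.1 (hL a)
  have hix' : ∀ i, ix (L.get i) = i := fun i => by
    refine List.nodup_iff_injective_get.1 nodup_quotVerts ?_
    exact (hix _).trans (mem_quotVerts.1 (List.get_mem _ _))
  have hadj : ∀ a b, (J.graph ⊕g H).Adj a b → (J.quotGraph H r h).graph.Adj (ix a) (ix b) :=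
    fun a b hab => ⟨a, b, (hix a).symm, (hix b).symm, hab⟩
  have hixid : ∀ a, ix (J.identify r a) = ix a := fun a =>
    List.nodup_iff_injective_get.1 nodup_quotVerts
      (((hix _).trans (identify_idem hr a)).trans (hix a).symm)
  refine
    { toFun := fun g => ⟨(⟨fun u => g (ix (.inl u)), fun {u v} huv => ?_⟩,
        ⟨fun x => g (ix (.inr x)), fun {x y} hxy => ?_⟩), ?_⟩
      invFun := fun p => ⟨fun i => Sum.elim p.1.1 p.1.2 (L.get i), fun {i j} hij => ?_⟩
      left_inv := ?_
      right_inv := ?_ }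
  · exact g.map_adj (hadj _ _ (by simpa using huv))
  · exact g.map_adj (hadj _ _ (by simpa using hxy))
  · rw [compatPair_iff]
    have : ∀ a, Sum.elim (fun u => g (ix (.inl u))) (fun x => g (ix (.inr x))) a = g (ix a) := by
      rintro (u | x) <;> rfl
    intro a
    exact (this _).trans ((congrArg g (hixid a)).trans (this a).symm)
  · exact p.2.adj_of_quotAdj hij
  · intro g
    ext i
    have : ∀ a, Sum.elim (fun u => g (ix (.inl u))) (fun x => g (ix (.inr x))) a = g (ix a) := by
      rintro (u | x) <;> rfl
    exact (this _).trans (congrArg g (hix' i))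
  · rintro ⟨⟨σ, φ⟩, hp⟩
    have hp' := compatPair_iff.1 hp
    refine Subtype.ext (Prod.ext ?_ ?_)
    · ext u
      exact (congrArg (Sum.elim σ φ) (hix (.inl u))).trans (hp' (.inl u))
    · ext x
      exact (congrArg (Sum.elim σ φ) (hix (.inr x))).trans (hp' (.inr x))

/-- A loop of the quotient would be mapped to a loop of `H`. -/
theorem PartLabGraph.isEmpty_compatPair {a : Fin J.n ⊕ V} (h : J.QuotAdj H r a a) :
    IsEmpty {p // J.CompatPair H r p} :=
  ⟨fun p => H.loopless.irrefl _ (p.2.adj_of_quotAdj h)⟩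

end Query

/-! ### The counting identity -/

/-- Pairs with an injective endomorphism amount to an automorphism and a homomorphism that respects
the labels. -/
noncomputable def PartLabGraph.injPairEquiv {V : Type} [Finite V] (J : PartLabGraph V)
    (H : SimpleGraph V) :
    {p : (J.graph →g H) × (H →g H) //
      Function.Injective p.2 ∧ ∀ u y, J.pin u = some y → p.1 u = p.2 y} ≃ (H ≃g H) × J.Homs H where
  toFun p := (autOfInjective p.1.2 p.2.1,
    ⟨(autOfInjective p.1.2 p.2.1).symm.toHom.comp p.1.1, fun u y h => by
      show (autOfInjective p.1.2 p.2.1).symm (p.1.1 u) = y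
      rw [p.2.2 u y h, ← autOfInjective_apply p.1.2 p.2.1, RelIso.symm_apply_apply]⟩)
  invFun q := ⟨(q.1.toHom.comp q.2.1, q.1.toHom), q.1.injective, fun u y h =>
    congrArg q.1 (q.2.2 u y h)⟩
  left_inv := by
    rintro ⟨⟨σ, φ⟩, hφ, h⟩
    refine Subtype.ext (Prod.ext ?_ ?_)
    · ext u
      exact (autOfInjective φ hφ).apply_symm_apply (σ u)
    · ext x
      rfl
  right_inv := by
    rintro ⟨ρ, σ, h⟩
    have e : autOfInjective ρ.toHom ρ.injective = ρ := by
      ext x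
      rfl
    refine Prod.ext e (Subtype.ext ?_)
    ext u
    exact (congrArg (fun α : H ≃g H => α.symm (ρ (σ u))) e).trans (ρ.symm_apply_apply (σ u))

/-- Exchange the sums: a fixed pair contributes the indicator that its endomorphism is injective, so
the total counts the pairs of `injPairEquiv`, and the factor `|Aut H|` is 1 modulo 2. -/
theorem PartLabGraph.sum_card_compatPair {V : Type} [Fintype V] (J : PartLabGraph V)
    {H : SimpleGraph V} (hH : InvolutionFree H) :
    ∑ S ∈ (Finset.univ : Finset V).offDiag.powerset,
      (Nat.card {p // J.CompatPair H (retraction S) p} : ZMod 2) = Nat.card (J.Homs H) := by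
  have : Finite (J.graph →g H) := DFunLike.finite _
  have : Finite (H →g H) := DFunLike.finite _
  have : Fintype ((J.graph →g H) × (H →g H)) := Fintype.ofFinite _
  have hc : ∀ P : (J.graph →g H) × (H →g H) → Prop,
      (Nat.card {p // P p} : ZMod 2) = ∑ p, if P p then 1 else 0 := by
    intro P
    rw [Nat.card_eq_fintype_card, Fintype.card_subtype, Finset.sum_boole]
  have h1 := Nat.card_congr (J.injPairEquiv H)
  rw [Nat.card_prod] at h1
  have h2 : (Nat.card (H ≃g H) : ZMod 2) = 1 := ZMod.natCast_eq_one_iff_odd.2 hH.odd_card_aut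
  have h3 := congrArg (Nat.cast : ℕ → ZMod 2) h1
  rw [Nat.cast_mul, h2, one_mul] at h3
  rw [← h3, hc]
  simp only [hc]
  rw [Finset.sum_comm]
  refine Finset.sum_congr rfl fun p _ => ?_
  have h4 := sum_retraction_eq_injective (p.2 : V → V)
  -- A pair that violates the pinning contributes 0 on both sides.
  by_cases hp : ∀ u y, J.pin u = some y → p.1 u = p.2 y
  · simp only [CompatPair, eq_true hp, true_and, and_true]
    exact h4
  · simp [CompatPair, hp]

/-! ### The oracle machine -/

section Machine

open Turing.TM2 (Stmt stepAux)

/-- Stack symbols. -/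
abbrev Symb (V : Type) : Type := Option V ⊕ Option Bool

/-- An output stack: for a set of identifications, the rows of the unlabelled vertices (`none`) or
the row of a label. -/
abbrev OutIndex (V : Type) : Type := Finset (V × V) × Option V

/-- The stacks. -/
inductive Tape (V : Type) : Type
  | input : Tape V
  | query : Tape V
  | pins : Tape V
  | pinsRev : Tape V
  | rowPins : Tape V
  | out : OutIndex V → Tape V

noncomputable instance (V : Type) : DecidableEq (Tape V) := Classical.decEq _

instance (V : Type) [Finite V] : Finite (Tape V) := by
  refine Finite.of_injective
    (fun t : Tape V => (match t with
      | .input => .inl 0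
      | .query => .inl 1
      | .pins => .inl 2
      | .pinsRev => .inl 3
      | .rowPins => .inl 4
      | .out k => .inr k : Fin 5 ⊕ OutIndex V)) ?_
  intro a b h
  cases a <;> cases b <;> simp_all

/-- Stack contents; those of the output stacks are listed from bottom to top. -/
def tapes {V : Type} (inp q pins pinsRev rowPins : List (Symb V)) (cont : OutIndex V → List (Symb V)) :
    Tape V → List (Symb V)
  | .input => inp
  | .query => q
  | .pins => pins
  | .pinsRev => pinsRev
  | .rowPins => rowPins
  | .out k => (cont k).reverse

/-! ### Rewriting rules for stack updates -/

section Tapes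

variable {V : Type} (inp q ps pr rp l : List (Symb V)) (cont : OutIndex V → List (Symb V)) (k : OutIndex V)

@[simp] theorem update_tapes_input :
    Function.update (tapes inp q ps pr rp cont) .input l = tapes l q ps pr rp cont := by
  funext t; cases t <;> simp [Function.update, tapes]

@[simp] theorem update_tapes_query :
    Function.update (tapes inp q ps pr rp cont) .query l = tapes inp l ps pr rp cont := by
  funext t; cases t <;> simp [Function.update, tapes]

@[simp] theorem update_tapes_pins :
    Function.update (tapes inp q ps pr rp cont) .pins l = tapes inp q l pr rp cont := by
  funext t; cases t <;> simp [Function.update, tapes]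

@[simp] theorem update_tapes_pinsRev :
    Function.update (tapes inp q ps pr rp cont) .pinsRev l = tapes inp q ps l rp cont := by
  funext t; cases t <;> simp [Function.update, tapes]

@[simp] theorem update_tapes_rowPins :
    Function.update (tapes inp q ps pr rp cont) .rowPins l = tapes inp q ps pr l cont := by
  funext t; cases t <;> simp [Function.update, tapes]

@[simp] theorem update_tapes_out :
    Function.update (tapes inp q ps pr rp cont) (.out k) l =
      tapes inp q ps pr rp (Function.update cont k l.reverse) := by
  funext t
  cases t with
  | out k' =>
    by_cases h : k' = k
    · subst h; simp [tapes]
    · simp [Function.update, tapes, h]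
  | _ => simp [Function.update, tapes]

@[simp] theorem tapes_input : tapes inp q ps pr rp cont .input = inp := rfl
@[simp] theorem tapes_query : tapes inp q ps pr rp cont .query = q := rfl
@[simp] theorem tapes_pins : tapes inp q ps pr rp cont .pins = ps := rfl
@[simp] theorem tapes_pinsRev : tapes inp q ps pr rp cont .pinsRev = pr := rfl
@[simp] theorem tapes_rowPins : tapes inp q ps pr rp cont .rowPins = rp := rfl
@[simp] theorem tapes_out : tapes inp q ps pr rp cont (.out k) = (cont k).reverse := rfl

end Tapes

/-- Internal states: two buffer cells, the label of the current row, the labels adjacent to the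
current row, the adjacent pairs of labels, and the sum of the answers. -/
structure State (V : Type) : Type where
  cell : Option (Symb V)
  pinCell : Option (Symb V)
  rowPin : Option V
  labelNbr : V → Bool
  labelAdj : V → V → Bool
  acc : ZMod 2

instance (V : Type) [Finite V] : Finite (State V) := by
  refine Finite.of_injective (fun s : State V =>
    (s.cell, s.pinCell, s.rowPin, s.labelNbr, s.labelAdj, s.acc)) ?_
  rintro ⟨⟩ ⟨⟩ h
  simp_all

/-- Empty the buffer cells. -/
def State.clear {V : Type} (s : State V) : State V := { s with cell := none, pinCell := none }

/-- The content of the first buffer cell. -/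
def State.symb {V : Type} (s : State V) : Symb V := s.cell.getD (.inl none)

/-- The content of the second buffer cell. -/
def State.pinSymb {V : Type} (s : State V) : Symb V := s.pinCell.getD (.inl none)

variable {V : Type} [Fintype V]

/-- What the machine does after reading the input: move output stacks to the query stack, and ask
the oracle. -/
noncomputable def block (S : Finset (V × V)) : List (OutIndex V ⊕ Finset (V × V)) :=
  ((fixedList (retraction S)).reverse.map fun c => Sum.inl (S, some c)) ++
    [Sum.inl (S, none), Sum.inr S]

/-- All sets of pairs of distinct labels. -/
noncomputable def pairSets (V : Type) [Fintype V] : List (Finset (V × V)) :=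
  (Finset.univ : Finset V).offDiag.powerset.toList

/-- The whole list of actions after reading the input. -/
noncomputable def actions (V : Type) [Fintype V] : List (OutIndex V ⊕ Finset (V × V)) :=
  (pairSets V).flatMap block

/-- The labels of the program. -/
inductive Label (V : Type) [Fintype V] : Type
  | readPins : Label V
  | turnPins : Label V
  | rowStart : Label V
  | entry : Label V
  | rewind : Label V
  | closing : Label V
  | assemble : {l : List (OutIndex V ⊕ Finset (V × V)) // l ∈ (actions V).tails} → Label V

/-- The list of actions depends only on the label set, and the control needs only to know which
suffix of it remains. -/
instance : Finite (Label V) := by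
  refine Finite.of_injective
    (fun t : Label V => (match t with
      | .readPins => .inl 0
      | .turnPins => .inl 1
      | .rowStart => .inl 2
      | .entry => .inl 3
      | .rewind => .inl 4
      | .closing => .inl 5
      | .assemble k => .inr k : Fin 6 ⊕ {l // l ∈ (actions V).tails})) ?_
  intro a b h
  cases a <;> cases b <;> simp_all

/-- Statements of the machine. -/
abbrev Code (V : Type) [Fintype V] : Type := Stmt (fun _ : Tape V => Symb V) (Label V) (State V)

/-- Push a list of symbols on an output stack. -/
def pushOut (k : OutIndex V) (l : List (State V → Symb V)) (q : Code V) : Code V :=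
  l.foldr (fun g q => .push (.out k) g q) q

/-- Push a list of symbols on each output stack. -/
noncomputable def pushAll (e : OutIndex V → List (State V → Symb V)) (q : Code V) : Code V :=
  (Finset.univ : Finset (OutIndex V)).toList.foldr (fun k q => pushOut k (e k) q) q

/-- A matrix entry. -/
noncomputable def bit (p : Prop) : Symb V := .inr (some (decide p))

/-- The symbols pushed at a matrix entry between unlabelled vertices. -/
def entrySymbs : OutIndex V → List (State V → Symb V)
  | (_, none) => [State.symb]
  | (_, some _) => []

/-- Adjacency to a class of labels. -/
def ClassNbr (S : Finset (V × V)) (f : V → Bool) (c : V) : Prop :=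
  ∃ y, retraction S y = c ∧ f y

/-- The symbols pushed at the end of the row of an unlabelled vertex. -/
noncomputable def rowEndSymbs (k : OutIndex V) : List (State V → Symb V) :=
  match k.2 with
  | none => ((fixedList (retraction k.1)).map fun c =>
      (fun s => bit (ClassNbr k.1 s.labelNbr c) : State V → Symb V)) ++
      [Function.const (State V) (.inr none : Symb V)]
  | some c => [fun s => bit (ClassNbr k.1 s.labelNbr c)]

/-- Adjacency of classes of labels. -/
def ClassAdj (H : SimpleGraph V) (S : Finset (V × V)) (W : V → V → Bool) (c d : V) : Prop :=
  ∃ x y, retraction S x = c ∧ retraction S y = d ∧ (W x y ∨ H.Adj x y)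

/-- The symbols pushed at the end of the input. -/
noncomputable def closingSymbs (H : SimpleGraph V) (k : OutIndex V) : List (State V → Symb V) :=
  match k.2 with
  | none => []
  | some c => ((fixedList (retraction k.1)).map fun d =>
      (fun s => bit (ClassAdj H k.1 s.labelAdj c d) : State V → Symb V)) ++
      [Function.const (State V) (.inr none : Symb V)]

/-- The use made of the answer to a query, which is ignored if the quotient has a loop. -/
noncomputable def recordAnswer (H : SimpleGraph V) (S : Finset (V × V)) (s : State V) (b : ZMod 2) :
    State V :=
  if ∃ c, ClassAdj H S s.labelAdj c c then s else { s with acc := s.acc + b }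

/-- Copy a symbol to the first buffer cell. -/
def State.store (s : State V) (a : Option (Symb V)) : State V := { s with cell := a }

/-- Copy a symbol to the second buffer cell. -/
def State.storePin (s : State V) (a : Option (Symb V)) : State V := { s with pinCell := a }

/-- Record the label of the current row. -/
def State.beginRow (s : State V) : State V :=
  { s with cell := none, rowPin := s.symb.elim id fun _ => none }

/-- Record an entry in a labelled column. -/
noncomputable def State.recordNbr (s : State V) : State V :=
  { s with
    cell := none
    pinCell := none
    labelNbr := fun y => s.labelNbr y || decide (s.pinSymb = .inl (some y) ∧
      s.symb = .inr (some true)) }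

/-- Finish the current row. -/
noncomputable def State.endRow (s : State V) : State V :=
  { s with
    cell := none
    rowPin := none
    labelNbr := fun _ => false
    labelAdj := fun x y => s.labelAdj x y || decide (s.rowPin = some x ∧ s.labelNbr y) }

/-- The program. -/
noncomputable def program (H : SimpleGraph V) :
    Label V → OracleInstr (fun _ : Tape V => Symb V) (Label V) (State V)
  -- An empty cell reads as the default `.inl none`, which looks like a table entry; the test
  -- `isSome` is what stops the loop on the empty input.
  | .readPins => .run <| .peek .input State.store <| .branch (fun s => s.symb.isLeft && s.cell.isSome)
      (.pop .input (fun s _ => s) <| .push .pinsRev State.symb <| .load State.clear <|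
        .goto fun _ => .readPins)
      (.load State.clear <| .goto fun _ => .turnPins)
  | .turnPins => .run <| .pop .pinsRev State.store <| .branch (fun s => s.cell.isSome)
      (.push .pins State.symb <| .push .rowPins State.symb <| .load State.clear <|
        .goto fun _ => .turnPins)
      (.load State.clear <| .goto fun _ => .rowStart)
  | .rowStart => .run <| .pop .rowPins State.store <| .branch (fun s => s.cell.isSome)
      (.load State.beginRow <| .goto fun _ => .entry)
      (.load State.clear <| .goto fun _ => .closing)
  | .entry => .run <| .pop .input State.store <| .branch (fun s => s.symb = .inr none)
      (.branch (fun s => s.rowPin.isNone)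
        (pushAll rowEndSymbs <| .load State.endRow <| .goto fun _ => .rewind)
        (.load State.endRow <| .goto fun _ => .rewind))
      (.pop .pins State.storePin <| .push .pinsRev State.pinSymb <|
        .branch (fun s => s.rowPin.isNone && decide (s.pinSymb = .inl none))
          (pushAll entrySymbs <| .load State.clear <| .goto fun _ => .entry)
          -- Also reached for a labelled row and an unlabelled column, where nothing is recorded:
          -- the symmetric entry provides the information.
          (.load State.recordNbr <| .goto fun _ => .entry))
  | .rewind => .run <| .pop .pinsRev State.store <| .branch (fun s => s.cell.isSome)
      (.push .pins State.symb <| .load State.clear <| .goto fun _ => .rewind)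
      (.load State.clear <| .goto fun _ => .rowStart)
  | .closing => .run <| pushAll (closingSymbs H) <|
      .goto fun _ => .assemble ⟨actions V, by simp⟩
  | .assemble ⟨[], _⟩ => .run .halt
  | .assemble ⟨.inl k :: l, h⟩ => .run <| .pop (.out k) State.store <|
      .branch (fun s => s.cell.isSome)
        (.push .query State.symb <| .load State.clear <| .goto fun _ => .assemble ⟨.inl k :: l, h⟩)
        (.load State.clear <| .goto fun _ => .assemble ⟨l, by
          simp only [List.mem_tails] at h ⊢
          exact (List.suffix_cons _ _).trans h⟩)
  | .assemble ⟨.inr S :: l, h⟩ => .ask (recordAnswer H S) (.assemble ⟨l, by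
      simp only [List.mem_tails] at h ⊢
      exact (List.suffix_cons _ _).trans h⟩)

/-- The oracle machine that reduces `⊕PartLabHomsToH` to `⊕HomsToH`. -/
noncomputable def machine (H : SimpleGraph V) : OracleTM (Symb V) (Option Bool) where
  K := Tape V
  Γ := fun _ => Symb V
  Λ := Label V
  σ := State V
  input := .input
  inSym := id
  query := .query
  querySym := Sum.elim (fun _ => none) id
  main := .readPins
  initialState := ⟨none, none, none, fun _ => false, fun _ _ => false, 0⟩
  prog := program H
  out := State.acc

/-! ### Pushing on the output stacks -/

section Stacks

variable (inp q ps pr rp : List (Symb V)) (cont : OutIndex V → List (Symb V)) (k : OutIndex V)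

/-- Output stacks are listed from bottom to top, so pushes become appends; pushing leaves the state
unchanged, so every symbol is computed from the same `s`. -/
theorem stepAux_pushOut (gs : List (State V → Symb V)) (c : Code V) (s : State V) :
    stepAux (pushOut k gs c) s (tapes inp q ps pr rp cont) =
      stepAux c s (tapes inp q ps pr rp (Function.update cont k (cont k ++ gs.map (· s)))) := by
  induction gs generalizing cont with
  | nil => simp [pushOut]
  | cons g gs ih =>
    have := ih (Function.update cont k (cont k ++ [g s]))
    simp only [pushOut] at this
    simp [pushOut, this]

@[simp] theorem stepAux_pushAll (e : OutIndex V → List (State V → Symb V)) (c : Code V)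
    (s : State V) :
    stepAux (pushAll e c) s (tapes inp q ps pr rp cont) =
      stepAux c s (tapes inp q ps pr rp fun k => cont k ++ (e k).map (· s)) := by
  -- Absence of repetitions ensures that each stack receives its symbols once.
  have key : ∀ (ks : List (OutIndex V)) (_ : ks.Nodup) (cont : OutIndex V → List (Symb V)),
      stepAux (ks.foldr (fun k q => pushOut k (e k) q) c) s (tapes inp q ps pr rp cont) =
        stepAux c s (tapes inp q ps pr rp fun k =>
          if k ∈ ks then cont k ++ (e k).map (· s) else cont k) := by
    intro ks
    induction ks with
    | nil => simp
    | cons k ks ih =>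
      intro hk cont
      rw [List.nodup_cons] at hk
      rw [List.foldr_cons, stepAux_pushOut, ih hk.2]
      congr 2
      funext k'
      by_cases h : k' = k
      · subst h; simp [hk.1]
      · simp [h]
  rw [pushAll, key _ (Finset.nodup_toList _)]
  simp

end Stacks

end Machine

/-! ### Runs of the machine -/

section Runs

variable {V : Type} [Fintype V] {H : SimpleGraph V} {O : List (Option Bool) → ZMod 2}

/-- Configurations of the machine. -/
abbrev Conf (V : Type) [Fintype V] : Type :=
  Turing.TM2.Cfg (fun _ : Tape V => Symb V) (Label V) (State V)

/-- The step function of the machine. -/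
noncomputable def machineStep (H : SimpleGraph V) (O : List (Option Bool) → ZMod 2) :
    Conf V → Option (Conf V) :=
  (machine H).step O

/-- The machine passes from one configuration to another in exactly `t` steps. -/
def Runs (H : SimpleGraph V) (O : List (Option Bool) → ZMod 2) (c : Conf V) (t : ℕ) (c' : Conf V) :
    Prop :=
  (flip bind (machineStep H O))^[t] (some c) = some c'

theorem Runs.refl (c : Conf V) : Runs H O c 0 c := rfl

theorem Runs.trans {c c' c'' : Conf V} {t t' : ℕ} (h : Runs H O c t c') (h' : Runs H O c' t' c'') :
    Runs H O c (t + t') c'' := by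
  rw [Runs, add_comm, Function.iterate_add_apply, h, h']

theorem Runs.of_run {l : Label V} {q : Code V} (h : program H l = .run q) {s : State V}
    {T : Tape V → List (Symb V)} {c : Conf V} (hc : Turing.TM2.stepAux q s T = c) :
    Runs H O ⟨some l, s, T⟩ 1 c := by
  have h' : (machine H).prog l = .run q := h
  have : (machine H).step O ⟨some l, s, T⟩ = some (Turing.TM2.stepAux q s T) := by
    simp only [OracleTM.step, h']
    rfl
  exact this.trans (congrArg some hc)

theorem Runs.of_ask {l l' : Label V} {f : State V → ZMod 2 → State V} (h : program H l = .ask f l')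
    {s : State V} {T : Tape V → List (Symb V)} :
    Runs H O ⟨some l, s, T⟩ 1
      ⟨some l', f s (O ((T .query).map (Sum.elim (fun _ => none) id))),
        Function.update T .query []⟩ := by
  have h' : (machine H).prog l = .ask f l' := h
  have : (machine H).step O ⟨some l, s, T⟩ = some
      ⟨some l', f s (O ((T .query).map (Sum.elim (fun _ => none) id))),
        Function.update T .query []⟩ := by
    simp only [OracleTM.step, h']
    rfl
  exact this

end Runs

/-! ### Reading the input -/

/-- The table of the pinning function. -/
def pinTable {V : Type} (J : PartLabGraph V) : List (Symb V) :=
  (List.finRange J.n).map fun v => .inl (J.pin v)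

theorem length_pinTable {V : Type} (J : PartLabGraph V) : (pinTable J).length = J.n := by
  simp [pinTable]

/-- The row of `u` in the adjacency matrix. -/
noncomputable def rowString {V : Type} (J : PartLabGraph V) (u : Fin J.n) : List (Symb V) :=
  ((List.finRange J.n).map fun v => bit (J.graph.Adj u v)) ++ [.inr none]

theorem map_encode_inr {V : Type} (J : PartLabGraph V) :
    J.toInputGraph.encode.map Sum.inr = (List.finRange J.n).flatMap (rowString J) := by
  simp [InputGraph.encode, List.map_flatMap, Function.comp_def]
  rfl

section Phases

variable {V : Type} [Fintype V] {H : SimpleGraph V} {O : List (Option Bool) → ZMod 2}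

/-- A state with empty buffer cells. -/
def cleanState (rowPin : Option V) (f : V → Bool) (W : V → V → Bool) (acc : ZMod 2) : State V :=
  ⟨none, none, rowPin, f, W, acc⟩

theorem runs_readPins (s : State V) (hs : s.clear = s) (cont : OutIndex V → List (Symb V))
    (m : List (Option Bool)) (ps : List (Option V)) (pr : List (Symb V)) :
    Runs H O ⟨some .readPins, s, tapes (ps.map .inl ++ m.map .inr) [] [] pr [] cont⟩ (ps.length + 1)
      ⟨some .turnPins, s, tapes (m.map .inr) [] [] ((ps.map .inl).reverse ++ pr) [] cont⟩ := by
  induction ps generalizing pr with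
  | nil =>
    refine Runs.of_run rfl ?_
    cases m <;> simp [Turing.TM2.stepAux, State.store, State.symb] <;> exact hs
  | cons p ps ih =>
    have h := ih (.inl p :: pr)
    simp only [List.map_cons, List.length_cons, List.reverse_cons, List.append_assoc,
      List.cons_append]
    rw [Nat.add_comm]
    refine Runs.trans (Runs.of_run rfl ?_) h
    simp [Turing.TM2.stepAux, State.store, State.symb]
    exact hs

theorem runs_turnPins (s : State V) (hs : s.clear = s) (cont : OutIndex V → List (Symb V))
    (inp pr ps rp : List (Symb V)) :
    Runs H O ⟨some .turnPins, s, tapes inp [] ps pr rp cont⟩ (pr.length + 1)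
      ⟨some .rowStart, s, tapes inp [] (pr.reverse ++ ps) [] (pr.reverse ++ rp) cont⟩ := by
  induction pr generalizing ps rp with
  | nil =>
    refine Runs.of_run rfl ?_
    simp [Turing.TM2.stepAux, State.store]
    exact hs
  | cons p pr ih =>
    have h := ih (p :: ps) (p :: rp)
    simp only [List.length_cons, List.reverse_cons, List.append_assoc, List.singleton_append]
    rw [Nat.add_comm]
    refine Runs.trans (Runs.of_run rfl ?_) h
    simp [Turing.TM2.stepAux, State.store, State.symb]
    exact hs

theorem runs_rewind (s : State V) (hs : s.clear = s) (cont : OutIndex V → List (Symb V))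
    (inp pr ps rp : List (Symb V)) :
    Runs H O ⟨some .rewind, s, tapes inp [] ps pr rp cont⟩ (pr.length + 1)
      ⟨some .rowStart, s, tapes inp [] (pr.reverse ++ ps) [] rp cont⟩ := by
  induction pr generalizing ps with
  | nil =>
    refine Runs.of_run rfl ?_
    simp [Turing.TM2.stepAux, State.store]
    exact hs
  | cons p pr ih =>
    have h := ih (p :: ps)
    simp only [List.length_cons, List.reverse_cons, List.append_assoc, List.singleton_append]
    rw [Nat.add_comm]
    refine Runs.trans (Runs.of_run rfl ?_) h
    simp [Turing.TM2.stepAux, State.store, State.symb]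
    exact hs

variable (J : PartLabGraph V)

/-- The labels of the neighbours of `u` among `vs`. -/
noncomputable def nbrLabels (u : Fin J.n) (vs : List (Fin J.n)) (y : V) : Bool :=
  decide (∃ v ∈ vs, J.pin v = some y ∧ J.graph.Adj u v)

/-- The entries of the row of `u` in the unlabelled columns among `vs`. -/
noncomputable def freeEntries (u : Fin J.n) (vs : List (Fin J.n)) (k : OutIndex V) :
    List (Symb V) :=
  if J.pin u = none ∧ k.2 = none then
    (vs.filter fun v => J.pin v = none).map fun v => bit (J.graph.Adj u v)
  else []

theorem runs_entries (u : Fin J.n) (W : V → V → Bool) (acc : ZMod 2) (rest rp : List (Symb V))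
    (vs : List (Fin J.n)) (f : V → Bool) (cont : OutIndex V → List (Symb V)) (pr : List (Symb V)) :
    Runs H O
      ⟨some .entry, cleanState (J.pin u) f W acc,
        tapes ((vs.map fun v => bit (J.graph.Adj u v)) ++ rest) [] (vs.map fun v => .inl (J.pin v))
          pr rp cont⟩
      vs.length
      ⟨some .entry, cleanState (J.pin u) (fun y => f y || nbrLabels J u vs y) W acc,
        tapes rest [] [] ((vs.map fun v => .inl (J.pin v)).reverse ++ pr) rp
          fun k => cont k ++ freeEntries J u vs k⟩ := by
  induction vs generalizing f cont pr with
  | nil =>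
    simp [nbrLabels, freeEntries]
    exact Runs.refl _
  | cons v vs ih =>
    have h := ih (fun y => f y || nbrLabels J u [v] y) (fun k => cont k ++ freeEntries J u [v] k)
      (.inl (J.pin v) :: pr)
    have e1 : (fun y => (f y || nbrLabels J u [v] y) || nbrLabels J u vs y) =
        fun y => f y || nbrLabels J u (v :: vs) y := by
      funext y
      rw [Bool.or_assoc]
      congr 1
      simp [nbrLabels]
    have e2 : (fun k => cont k ++ freeEntries J u [v] k ++ freeEntries J u vs k) =
        fun k => cont k ++ freeEntries J u (v :: vs) k := by
      funext k
      by_cases hk : J.pin u = none ∧ k.2 = none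
      · by_cases hv : J.pin v = none <;> simp [freeEntries, hk, hv]
      · simp [freeEntries, hk]
    rw [e1, e2] at h
    simp only [List.map_cons, List.length_cons, List.reverse_cons, List.append_assoc,
      List.cons_append]
    rw [Nat.add_comm]
    refine Runs.trans (Runs.of_run rfl ?_) h
    -- Either the entry is copied to the stacks of unlabelled rows, or it can only affect the
    -- recorded neighbouring labels.
    by_cases hc : J.pin u = none ∧ J.pin v = none
    · simp [Turing.TM2.stepAux, State.store, State.symb, State.storePin, State.pinSymb, bit,
        cleanState, hc, State.clear]
      refine ⟨?_, ?_⟩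
      · funext y
        simp [nbrLabels, hc.2]
      · congr 1
        funext ⟨S, k⟩
        cases k <;> simp [entrySymbs, freeEntries, hc, State.symb, bit]
    · have hc' : ((J.pin u).isNone && decide (J.pin v = none)) = false := by
        rw [Bool.eq_false_iff]
        simpa using hc
      simp [Turing.TM2.stepAux, State.store, State.symb, State.storePin, State.pinSymb, bit,
        cleanState, hc', State.recordNbr]
      refine ⟨?_, ?_⟩
      · funext y
        simp [nbrLabels]
      · congr 1
        funext k
        by_cases hv : J.pin v = none
        · have hu : J.pin u ≠ none := fun h => hc ⟨h, hv⟩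
          simp [freeEntries, hu]
        · simp [freeEntries, hv]

/-- What the row of `u` contributes to the output stacks. -/
noncomputable def rowOut (u : Fin J.n) (k : OutIndex V) : List (Symb V) :=
  if J.pin u = none then
    match k.2 with
    | none => (J.free.map fun v => bit (J.graph.Adj u v)) ++
        ((fixedList (retraction k.1)).map fun c =>
          bit (ClassNbr k.1 (nbrLabels J u (List.finRange J.n)) c)) ++ [.inr none]
    | some c => [bit (ClassNbr k.1 (nbrLabels J u (List.finRange J.n)) c)]
  else []

/-- What the row of `u` contributes to the adjacency of labels. -/
noncomputable def rowLabelAdj (u : Fin J.n) (x y : V) : Bool :=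
  decide (J.pin u = some x ∧ nbrLabels J u (List.finRange J.n) y)

/-- The count is one step to fetch the label of the row, `n` entries, one end marker, and `n + 1`
steps to restore the pin table, the last of which detects the empty stack. -/
theorem runs_row (u : Fin J.n) (W : V → V → Bool) (acc : ZMod 2) (rest rp : List (Symb V))
    (cont : OutIndex V → List (Symb V)) :
    Runs H O
      ⟨some .rowStart, cleanState none (fun _ => false) W acc,
        tapes (rowString J u ++ rest) [] (pinTable J) [] (.inl (J.pin u) :: rp) cont⟩
      (2 * J.n + 3)
      ⟨some .rowStart, cleanState none (fun _ => false) (fun x y => W x y || rowLabelAdj J u x y) acc,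
        tapes rest [] (pinTable J) [] rp fun k => cont k ++ rowOut J u k⟩ := by
  have h1 : Runs H O
      ⟨some .rowStart, cleanState none (fun _ => false) W acc,
        tapes (rowString J u ++ rest) [] (pinTable J) [] (.inl (J.pin u) :: rp) cont⟩ 1
      ⟨some .entry, cleanState (J.pin u) (fun _ => false) W acc,
        tapes (rowString J u ++ rest) [] (pinTable J) [] rp cont⟩ := by
    refine Runs.of_run rfl ?_
    simp [Turing.TM2.stepAux, State.store, State.symb, State.beginRow, cleanState]
  have h2 := runs_entries (H := H) (O := O) J u W acc (.inr none :: rest) rp (List.finRange J.n)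
    (fun _ => false) cont []
  have h3 : Runs H O
      ⟨some .entry, cleanState (J.pin u) (fun y => false || nbrLabels J u (List.finRange J.n) y)
          W acc,
        tapes (.inr none :: rest) [] [] ((pinTable J).reverse ++ []) rp
          fun k => cont k ++ freeEntries J u (List.finRange J.n) k⟩ 1
      ⟨some .rewind, cleanState none (fun _ => false) (fun x y => W x y || rowLabelAdj J u x y) acc,
        tapes rest [] [] (pinTable J).reverse rp fun k => cont k ++ rowOut J u k⟩ := by
    refine Runs.of_run rfl ?_
    by_cases hu : J.pin u = none
    · simp [Turing.TM2.stepAux, State.store, State.symb, State.endRow, cleanState, rowLabelAdj, hu]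
      congr 1
      funext ⟨S, k⟩
      cases k <;> simp [rowEndSymbs, freeEntries, rowOut, hu, PartLabGraph.free, Function.comp_def]
    · have hu' : (J.pin u).isNone = false := by
        rw [Bool.eq_false_iff]
        simpa using hu
      simp [Turing.TM2.stepAux, State.store, State.symb, State.endRow, cleanState, rowLabelAdj, hu']
      congr 1
      funext k
      simp [freeEntries, rowOut, hu]
  have h4 := runs_rewind (H := H) (O := O)
    (cleanState none (fun _ => false) (fun x y => W x y || rowLabelAdj J u x y) acc) rfl
    (fun k => cont k ++ rowOut J u k) rest (pinTable J).reverse [] rp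
  rw [List.reverse_reverse, List.append_nil] at h4
  have es : rowString J u ++ rest =
      ((List.finRange J.n).map fun v => bit (J.graph.Adj u v)) ++ .inr none :: rest := by
    simp [rowString]
  rw [es] at h1 ⊢
  have h := ((h1.trans h2).trans h3).trans h4
  have ht : 1 + (List.finRange J.n).length + 1 + ((pinTable J).reverse.length + 1) =
      2 * J.n + 3 := by
    rw [List.length_finRange, List.length_reverse, length_pinTable]
    ring
  rwa [ht] at h

theorem runs_rows (acc : ZMod 2) (us : List (Fin J.n)) (W : V → V → Bool)
    (cont : OutIndex V → List (Symb V)) :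
    Runs H O
      ⟨some .rowStart, cleanState none (fun _ => false) W acc,
        tapes (us.flatMap (rowString J)) [] (pinTable J) [] (us.map fun u => .inl (J.pin u)) cont⟩
      (us.length * (2 * J.n + 3) + 1)
      ⟨some .closing, cleanState none (fun _ => false)
          (fun x y => W x y || decide (∃ u ∈ us, rowLabelAdj J u x y)) acc,
        tapes [] [] (pinTable J) [] [] fun k => cont k ++ us.flatMap (rowOut J · k)⟩ := by
  induction us generalizing W cont with
  | nil =>
    rw [List.length_nil, zero_mul, zero_add]
    refine Runs.of_run rfl ?_
    simp [Turing.TM2.stepAux, State.store, State.clear, cleanState]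
  | cons u us ih =>
    have h := ih (fun x y => W x y || rowLabelAdj J u x y) (fun k => cont k ++ rowOut J u k)
    have hrow := (runs_row (H := H) (O := O) J u W acc (us.flatMap (rowString J))
      (us.map fun u => .inl (J.pin u)) cont).trans h
    have ht : (u :: us).length * (2 * J.n + 3) + 1 =
        2 * J.n + 3 + (us.length * (2 * J.n + 3) + 1) := by
      rw [List.length_cons]
      ring
    rw [ht]
    simpa [Bool.or_assoc] using hrow

/-- What the input contributes to the adjacency of labels. -/
noncomputable def pinAdj (x y : V) : Bool :=
  decide (∃ u v, J.pin u = some x ∧ J.pin v = some y ∧ J.graph.Adj u v)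

/-- The final contents of the output stacks. -/
noncomputable def finalOut (H : SimpleGraph V) (k : OutIndex V) : List (Symb V) :=
  (List.finRange J.n).flatMap (rowOut J · k) ++
    (closingSymbs H k).map (· (cleanState none (fun _ => false) (pinAdj J) 0))

theorem runs_reading :
    Runs H O
      ⟨some .readPins, cleanState none (fun _ => false) (fun _ _ => false) 0,
        tapes J.encode [] [] [] [] fun _ => []⟩
      ((J.n + 1) + (J.n + 1) + (J.n * (2 * J.n + 3) + 1) + 1)
      ⟨some (.assemble ⟨actions V, by simp⟩), cleanState none (fun _ => false) (pinAdj J) 0,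
        tapes [] [] (pinTable J) [] [] (finalOut J H)⟩ := by
  have h1 := runs_readPins (H := H) (O := O)
    (cleanState none (fun _ => false) (fun _ _ => false) 0) rfl (fun _ => []) J.toInputGraph.encode
    ((List.finRange J.n).map J.pin) []
  have h2 := runs_turnPins (H := H) (O := O)
    (cleanState none (fun _ => false) (fun _ _ => false) 0) rfl (fun _ => [])
    (J.toInputGraph.encode.map .inr) ((pinTable J).reverse) [] []
  have h3 := runs_rows (H := H) (O := O) J 0 (List.finRange J.n) (fun _ _ => false) (fun _ => [])
  have e1 : ((List.finRange J.n).map J.pin).map Sum.inl = pinTable J := by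
    simp [pinTable]
  have e2 : (fun x y => false || decide (∃ u ∈ List.finRange J.n, rowLabelAdj J u x y)) =
      pinAdj J := by
    funext x y
    simp [pinAdj, rowLabelAdj, nbrLabels]
  rw [e1, List.append_nil] at h1
  rw [List.reverse_reverse, List.append_nil, map_encode_inr] at h2
  rw [e2] at h3
  rw [map_encode_inr] at h1
  have h := (h1.trans h2).trans h3
  rw [List.length_map, List.length_reverse, length_pinTable, List.length_finRange] at h
  have e3 : J.encode = pinTable J ++ (List.finRange J.n).flatMap (rowString J) := by
    rw [PartLabGraph.encode, map_encode_inr]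
    rfl
  rw [e3]
  refine Runs.trans h (Runs.of_run rfl ?_)
  simp [Turing.TM2.stepAux]
  rfl

end Phases

/-! ### The final contents of the output stacks -/

section Contents

variable {V : Type} (J : PartLabGraph V) (H : SimpleGraph V) (S : Finset (V × V))

/-- An unlabelled vertex is alone in its class, which is `key`. -/
theorem quotAdj_inl_inl {V : Type} {J : PartLabGraph V} {H : SimpleGraph V} {r : V → V}
    {u v : Fin J.n} (hu : J.pin u = none) (hv : J.pin v = none) :
    J.QuotAdj H r (.inl u) (.inl v) ↔ J.graph.Adj u v := by
  have key : ∀ {a : Fin J.n ⊕ V} {w : Fin J.n}, J.identify r a = .inl w → a = .inl w := by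
    rintro (a | x) w h
    · rcases hp : J.pin a with _ | y
      · simpa [PartLabGraph.identify, hp] using h
      · simp [PartLabGraph.identify, hp] at h
    · simp [PartLabGraph.identify] at h
  constructor
  · rintro ⟨a, b, ha, hb, h⟩
    rw [key ha, key hb] at h
    simpa using h
  · intro h
    exact ⟨.inl u, .inl v, by simp [PartLabGraph.identify, hu], by simp [PartLabGraph.identify, hv],
      by simpa using h⟩

/-- The disjoint union has no edges between its two sides, so such an edge comes from an edge
between `u` and a pinned vertex. -/
theorem quotAdj_inl_inr {u : Fin J.n} (hu : J.pin u = none) (c : V) :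
    J.QuotAdj H (retraction S) (.inl u) (.inr c) ↔
      ClassNbr S (nbrLabels J u (List.finRange J.n)) c := by
  constructor
  · rintro ⟨a | a, b | b, ha, hb, h⟩
    · rcases hp : J.pin a with _ | y
      · rcases hq : J.pin b with _ | z
        · simp [PartLabGraph.identify, hq] at hb
        · simp only [PartLabGraph.identify, hp, hq, Option.elim_none, Option.elim_some,
            Sum.inl.injEq, Sum.inr.injEq] at ha hb
          subst ha
          exact ⟨z, hb, by simpa [nbrLabels] using ⟨b, hq, by simpa using h⟩⟩
      · simp [PartLabGraph.identify, hp] at ha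
    · simp at h
    · simp at h
    · simp [PartLabGraph.identify] at ha
  · rintro ⟨y, hy, h⟩
    simp only [nbrLabels, List.mem_finRange, true_and, decide_eq_true_eq] at h
    obtain ⟨v, hv, h⟩ := h
    exact ⟨.inl u, .inl v, by simp [PartLabGraph.identify, hu],
      by simp [PartLabGraph.identify, hv, hy], by simpa using h⟩

/-- The edge comes either from two pinned vertices or from `H` itself; the machine knows the former
from its state and the latter from its program. -/
theorem quotAdj_inr_inr (c d : V) :
    J.QuotAdj H (retraction S) (.inr c) (.inr d) ↔ ClassAdj H S (pinAdj J) c d := by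
  constructor
  · rintro ⟨a | a, b | b, ha, hb, h⟩
    · rcases hp : J.pin a with _ | y
      · simp [PartLabGraph.identify, hp] at ha
      rcases hq : J.pin b with _ | z
      · simp [PartLabGraph.identify, hq] at hb
      simp only [PartLabGraph.identify, hp, hq, Option.elim_some, Sum.inr.injEq] at ha hb
      exact ⟨y, z, ha, hb, .inl (by simpa [pinAdj] using ⟨a, hp, b, hq, by simpa using h⟩)⟩
    · simp at h
    · simp at h
    · simp only [PartLabGraph.identify, Sum.inr.injEq] at ha hb
      exact ⟨a, b, ha, hb, .inr (by simpa using h)⟩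
  · rintro ⟨x, y, hx, hy, h | h⟩
    · simp only [pinAdj, decide_eq_true_eq] at h
      obtain ⟨u, v, hu, hv, h⟩ := h
      exact ⟨.inl u, .inl v, by simp [PartLabGraph.identify, hu, hx],
        by simp [PartLabGraph.identify, hv, hy], by simpa using h⟩
    · exact ⟨.inr x, .inr y, by simp [PartLabGraph.identify, hx],
        by simp [PartLabGraph.identify, hy], by simpa using h⟩

/-- A loop at an unlabelled vertex would already be a loop of the underlying graph, so the machine
can detect all loops from its finite state. -/
theorem exists_classAdj_iff :
    (∃ c, ClassAdj H S (pinAdj J) c c) ↔ ∃ a, J.QuotAdj H (retraction S) a a := by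
  constructor
  · rintro ⟨c, h⟩
    exact ⟨.inr c, (quotAdj_inr_inr J H S c c).2 h⟩
  · rintro ⟨a | c, h⟩
    · have hu : J.pin a = none := by
        obtain ⟨b | b, -, hb, -⟩ := h
        · rcases hp : J.pin b with _ | y
          · simp only [PartLabGraph.identify, hp, Option.elim_none, Sum.inl.injEq] at hb
            rwa [← hb]
          · simp [PartLabGraph.identify, hp] at hb
        · simp [PartLabGraph.identify] at hb
      exact absurd ((quotAdj_inl_inl hu hu).1 h) (J.graph.loopless.irrefl a)
    · exact ⟨c, (quotAdj_inr_inr J H S c c).1 h⟩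

variable [Fintype V]

/-- A row of the adjacency matrix of the quotient. -/
noncomputable def quotRow (a : Fin J.n ⊕ V) : List (Symb V) :=
  ((J.quotVerts (retraction S)).map fun b => bit (J.QuotAdj H (retraction S) a b)) ++ [.inr none]

theorem flatMap_ite_eq_filter {α β : Type} (p : α → Prop) [DecidablePred p] (f : α → List β) (l : List α) :
    (l.flatMap fun a => if p a then f a else []) = (l.filter fun a => p a).flatMap f := by
  induction l with
  | nil => rfl
  | cons a l ih => by_cases h : p a <;> simp [h, ih]

theorem flatMap_rowOut (k : OutIndex V) (f : Fin J.n → List (Symb V))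
    (hf : ∀ u, J.pin u = none → rowOut J u k = f u) :
    (List.finRange J.n).flatMap (rowOut J · k) = J.free.flatMap f := by
  rw [PartLabGraph.free, ← flatMap_ite_eq_filter (fun u => J.pin u = none)]
  congr 1
  funext u
  split_ifs with hu
  · exact hf u hu
  · simp [rowOut, hu]

theorem finalOut_none :
    finalOut J H (S, none) = J.free.flatMap fun u => quotRow J H S (.inl u) := by
  rw [finalOut, flatMap_rowOut J (S, none) fun u => quotRow J H S (.inl u)]
  · simp [closingSymbs]
  · intro u hu
    simp only [rowOut, hu, if_true, quotRow, PartLabGraph.quotVerts, List.map_append, List.map_map]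
    congr 2
    · refine List.map_congr_left fun v hv => ?_
      have hv' : J.pin v = none := by simpa [PartLabGraph.free] using hv
      simp only [Function.comp, quotAdj_inl_inl hu hv']
    · refine List.map_congr_left fun c _ => ?_
      simp only [Function.comp, quotAdj_inl_inr J H S hu]

/-- The row of a label class is collected as a column: each unlabelled row supplies one bit, correct
by symmetry of adjacency, and `closingSymbs` supplies the entries between classes and the end
marker. -/
theorem finalOut_some (c : V) : finalOut J H (S, some c) = quotRow J H S (.inr c) := by
  rw [finalOut, flatMap_rowOut J (S, some c) fun u =>
    [bit (J.QuotAdj H (retraction S) (.inr c) (.inl u))]]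
  · simp only [quotRow, PartLabGraph.quotVerts, List.map_append, List.map_map, closingSymbs,
      ← List.append_assoc, ← List.map_eq_flatMap]
    congr 2
    refine List.map_congr_left fun d _ => ?_
    simp only [Function.comp, quotAdj_inr_inr]
    rfl
  · intro u hu
    have : J.QuotAdj H (retraction S) (.inr c) (.inl u) ↔
        J.QuotAdj H (retraction S) (.inl u) (.inr c) := ⟨fun h => h.symm, fun h => h.symm⟩
    simp only [rowOut, hu, if_true, this, quotAdj_inl_inr J H S hu]

theorem finalOut_concat :
    finalOut J H (S, none) ++
      (fixedList (retraction S)).flatMap (fun c => finalOut J H (S, some c)) =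
      (J.quotEncode H (retraction S)).map Sum.inr := by
  simp only [finalOut_none, finalOut_some, PartLabGraph.quotEncode, List.map_flatMap]
  conv_rhs => rw [PartLabGraph.quotVerts, List.flatMap_append, List.flatMap_map, List.flatMap_map]
  simp [quotRow, bit, PartLabGraph.quotVerts, Function.comp_def]

theorem length_quotEncode_le :
    (J.quotEncode H (retraction S)).length ≤
      (J.n + Fintype.card V) * (J.n + Fintype.card V + 1) := by
  have h1 : (J.quotVerts (retraction S)).length ≤ J.n + Fintype.card V := by
    simp only [PartLabGraph.quotVerts, List.length_append, List.length_map]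
    refine Nat.add_le_add ?_ ?_
    · exact (List.length_filter_le _ _).trans (by simp)
    · exact (List.length_filter_le _ _).trans (by simp)
  have h2 : (J.quotEncode H (retraction S)).length =
      (J.quotVerts (retraction S)).length * ((J.quotVerts (retraction S)).length + 1) := by
    simp [PartLabGraph.quotEncode, List.length_flatMap]
  rw [h2]
  gcongr

end Contents

/-! ### Asking the oracle -/

section Assembly

variable {V : Type} [Fintype V] {H : SimpleGraph V} {O : List (Option Bool) → ZMod 2}

/-- A configuration in the last phase. -/
def assembling (l : List (OutIndex V ⊕ Finset (V × V))) (h : l ∈ (actions V).tails) (s : State V)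
    (q ps : List (Symb V)) (cont : OutIndex V → List (Symb V)) : Conf V :=
  ⟨some (.assemble ⟨l, h⟩), s, tapes [] q ps [] [] cont⟩

theorem mem_tails_of_append {α : Type} {l m a : List α} (h : l ++ m ∈ a.tails) : m ∈ a.tails := by
  rw [List.mem_tails] at h ⊢
  exact (List.suffix_append l m).trans h

/-- Popping one stack onto another reverses the order, so the earliest symbol written ends on top of
the query; the extra step finds the stack empty. -/
theorem runs_move (s : State V) (hs : s.clear = s) (k : OutIndex V)
    (l : List (OutIndex V ⊕ Finset (V × V))) (h : .inl k :: l ∈ (actions V).tails)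
    (ps xs q : List (Symb V)) (cont : OutIndex V → List (Symb V)) (hk : cont k = xs.reverse) :
    Runs H O (assembling (.inl k :: l) h s q ps cont) (xs.length + 1)
      (assembling l (mem_tails_of_append (l := [_]) h) s (xs.reverse ++ q) ps
        (Function.update cont k [])) := by
  induction xs generalizing q cont with
  | nil =>
    refine Runs.of_run rfl ?_
    simp [Turing.TM2.stepAux, State.store, hk, assembling]
    exact hs
  | cons x xs ih =>
    have h' := ih (x :: q) (Function.update cont k xs.reverse) (by simp)
    rw [Function.update_idem] at h'
    simp only [List.length_cons, List.reverse_cons, List.append_assoc, List.singleton_append]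
    rw [Nat.add_comm]
    refine Runs.trans (Runs.of_run rfl ?_) h'
    simp [Turing.TM2.stepAux, State.store, State.symb, hk, assembling]
    exact hs

/-- The stack moved last lies on top of the query, whence the reversal of `ks`. Stacks outside `ks`
must survive for later queries. -/
theorem runs_moves (s : State V) (hs : s.clear = s) (ps : List (Symb V))
    (l : List (OutIndex V ⊕ Finset (V × V))) (ks : List (OutIndex V)) (hnd : ks.Nodup)
    (h : ks.map .inl ++ l ∈ (actions V).tails) (q : List (Symb V))
    (cont : OutIndex V → List (Symb V)) :
    ∃ cont', (∀ k ∉ ks, cont' k = cont k) ∧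
      Runs H O (assembling (ks.map .inl ++ l) h s q ps cont)
        ((ks.reverse.flatMap cont).length + ks.length)
        (assembling l (mem_tails_of_append h) s (ks.reverse.flatMap cont ++ q) ps cont') := by
  induction ks generalizing q cont with
  | nil => exact ⟨cont, fun _ _ => rfl, Runs.refl _⟩
  | cons k ks ih =>
    rw [List.nodup_cons] at hnd
    have hk : .inl k :: (ks.map .inl ++ l) ∈ (actions V).tails := by simpa using h
    have h1 := runs_move (H := H) (O := O) s hs k (ks.map .inl ++ l) hk ps (cont k).reverse q cont
      (by simp)
    obtain ⟨cont', hc, h2⟩ := ih hnd.2 (mem_tails_of_append (l := [_]) hk) (cont k ++ q)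
      (Function.update cont k [])
    have e : ks.reverse.flatMap (Function.update cont k []) = ks.reverse.flatMap cont := by
      refine List.flatMap_congr fun k' hk' => ?_
      rw [Function.update_of_ne]
      rintro rfl
      exact hnd.1 (by simpa using hk')
    rw [e] at h2
    rw [List.reverse_reverse] at h1
    refine ⟨cont', fun k' hk' => ?_, ?_⟩
    · simp only [List.mem_cons, not_or] at hk'
      rw [hc k' hk'.2, Function.update_of_ne hk'.1]
    · have h3 := h1.trans h2
      have et : (cont k).reverse.length + 1 + ((ks.reverse.flatMap cont).length + ks.length) =
          ((k :: ks).reverse.flatMap cont).length + (k :: ks).length := by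
        simp
        ring
      rw [et] at h3
      simpa using h3

theorem recordAnswer_cleanState (S : Finset (V × V)) (W : V → V → Bool) (acc b : ZMod 2) :
    recordAnswer H S (cleanState none (fun _ => false) W acc) b =
      cleanState none (fun _ => false) W (acc + if ∃ c, ClassAdj H S W c c then 0 else b) := by
  by_cases h : ∃ c, ClassAdj H S W c c <;> simp [recordAnswer, cleanState, h]

variable (H O) in
/-- The contribution of a set of identifications to the answer. -/
noncomputable def contribution (J : PartLabGraph V) (S : Finset (V × V)) : ZMod 2 :=
  if ∃ c, ClassAdj H S (pinAdj J) c c then 0 else O (J.quotEncode H (retraction S))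

theorem runs_block (J : PartLabGraph V) (acc : ZMod 2) (S : Finset (V × V))
    (l : List (OutIndex V ⊕ Finset (V × V))) (h : block S ++ l ∈ (actions V).tails)
    (cont : OutIndex V → List (Symb V)) (hcont : ∀ o, cont (S, o) = finalOut J H (S, o)) :
    ∃ cont', (∀ S' o, S' ≠ S → cont' (S', o) = cont (S', o)) ∧
      ∃ t ≤ (J.n + Fintype.card V) * (J.n + Fintype.card V + 1) + Fintype.card V + 2,
      Runs H O
        (assembling (block S ++ l) h (cleanState none (fun _ => false) (pinAdj J) acc) []
          (pinTable J) cont) t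
        (assembling l (mem_tails_of_append h)
          (cleanState none (fun _ => false) (pinAdj J) (acc + contribution H O J S)) []
          (pinTable J) cont') := by
  let ks : List (OutIndex V) :=
    ((fixedList (retraction S)).reverse.map fun c => (S, some c)) ++ [(S, none)]
  have hb : block S ++ l = ks.map .inl ++ (.inr S :: l) := by
    simp [block, ks, Function.comp_def]
  have hnd : ks.Nodup := by
    refine List.Nodup.append ?_ (List.nodup_singleton _) (by simp)
    refine List.Nodup.map (fun a b hab => by simpa using hab) ?_
    exact List.nodup_reverse.2 ((Finset.nodup_toList _).filter _)
  have hq : ks.reverse.flatMap cont = (J.quotEncode H (retraction S)).map Sum.inr := by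
    rw [← finalOut_concat]
    simp [ks, List.flatMap_map, hcont]
  have hlen : ks.length ≤ Fintype.card V + 1 := by
    simp only [ks, List.length_append, List.length_map, List.length_reverse, List.length_singleton,
      Nat.add_le_add_iff_right]
    exact (List.length_filter_le _ _).trans (by simp)
  have h' : ks.map .inl ++ (.inr S :: l) ∈ (actions V).tails := hb ▸ h
  obtain ⟨cont', hc, hr⟩ := runs_moves (H := H) (O := O)
    (cleanState none (fun _ => false) (pinAdj J) acc) rfl (pinTable J) (.inr S :: l) ks hnd h' []
    cont
  rw [hq] at hr
  -- One step per symbol, one per emptied stack, and one for the query.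
  refine ⟨cont', fun S' o hS => hc _ (by simp [ks, hS, Ne.symm hS]),
    (J.quotEncode H (retraction S)).length + ks.length + 1, ?_, ?_⟩
  · have := length_quotEncode_le J H S
    omega
  · have ha : Runs H O (assembling (.inr S :: l) (mem_tails_of_append h')
        (cleanState none (fun _ => false) (pinAdj J) acc)
        ((J.quotEncode H (retraction S)).map Sum.inr ++ []) (pinTable J) cont') 1
        (assembling l (mem_tails_of_append h)
          (cleanState none (fun _ => false) (pinAdj J) (acc + contribution H O J S)) []
          (pinTable J) cont') := by
      have := Runs.of_ask (H := H) (O := O) (l := .assemble ⟨.inr S :: l, mem_tails_of_append h'⟩)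
        rfl (s := cleanState none (fun _ => false) (pinAdj J) acc)
        (T := tapes [] ((J.quotEncode H (retraction S)).map Sum.inr ++ []) (pinTable J) [] [] cont')
      rw [recordAnswer_cleanState] at this
      simpa [assembling, contribution] using this
    have := hr.trans ha
    rw [List.length_map] at this
    simpa only [hb] using this

theorem runs_blocks (J : PartLabGraph V) (Ss : List (Finset (V × V))) (hnd : Ss.Nodup)
    (h : Ss.flatMap block ∈ (actions V).tails) (acc : ZMod 2)
    (cont : OutIndex V → List (Symb V))
    (hcont : ∀ S ∈ Ss, ∀ o, cont (S, o) = finalOut J H (S, o)) :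
    ∃ cont', ∃ t ≤ Ss.length *
        ((J.n + Fintype.card V) * (J.n + Fintype.card V + 1) + Fintype.card V + 2) + 1,
      Runs H O
        (assembling (Ss.flatMap block) h (cleanState none (fun _ => false) (pinAdj J) acc) []
          (pinTable J) cont) t
        ⟨none, cleanState none (fun _ => false) (pinAdj J)
          (acc + (Ss.map (contribution H O J)).sum), tapes [] [] (pinTable J) [] [] cont'⟩ := by
  induction Ss generalizing acc cont with
  | nil =>
    refine ⟨cont, 1, by simp, Runs.of_run rfl ?_⟩
    simp [Turing.TM2.stepAux]
  | cons S Ss ih =>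
    rw [List.nodup_cons] at hnd
    obtain ⟨cont₁, hc₁, t₁, ht₁, hr₁⟩ := runs_block (H := H) (O := O) J acc S (Ss.flatMap block) h
      cont (hcont S (by simp))
    obtain ⟨cont₂, t₂, ht₂, hr₂⟩ := ih hnd.2 (mem_tails_of_append h) (acc + contribution H O J S)
      cont₁ (fun S' hS' o => by
        rw [hc₁ S' o (fun e => hnd.1 (e ▸ hS'))]
        exact hcont S' (by simp [hS']) o)
    refine ⟨cont₂, t₁ + t₂, ?_, ?_⟩
    · rw [List.length_cons, Nat.add_mul, Nat.one_mul]
      omega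
    · rw [List.map_cons, List.sum_cons, ← add_assoc]
      exact hr₁.trans hr₂

/-! ### Correctness of the answer and running time -/

/-- If the quotient has a loop, the string encodes no graph and the oracle's answer is discarded;
the true count is then 0. Otherwise the oracle counts the homomorphisms from the quotient, which are
the compatible pairs. -/
theorem contribution_eq (hO : (homsTo H).IsOracle O) (J : PartLabGraph V) (S : Finset (V × V)) :
    contribution H O J S = Nat.card {p // J.CompatPair H (retraction S) p} := by
  rw [contribution]
  split_ifs with h
  · obtain ⟨a, ha⟩ := (exists_classAdj_iff J H S).1 h
    have := PartLabGraph.isEmpty_compatPair ha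
    simp
  · rw [exists_classAdj_iff, not_exists] at h
    have h1 := hO (J.quotGraph H (retraction S) h)
    have h2 := Nat.card_congr (PartLabGraph.quotHomsEquiv (retraction_idem S) h)
    rw [← h2, ← PartLabGraph.encode_quotGraph h]
    exact h1

theorem sum_contribution (hH : InvolutionFree H) (hO : (homsTo H).IsOracle O)
    (J : PartLabGraph V) :
    ((pairSets V).map (contribution H O J)).sum = Nat.card (J.Homs H) := by
  rw [← J.sum_card_compatPair hH, pairSets, Finset.sum_map_toList]
  exact Finset.sum_congr rfl fun S _ => contribution_eq hO J S

variable (V) in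
/-- A polynomial that bounds the running time. -/
noncomputable def timeBound : Polynomial ℕ :=
  (.X + 1) + (.X + 1) + (.X * (2 * .X + 3) + 1) + 1 + (.C (pairSets V).length *
    ((.X + .C (Fintype.card V)) * (.X + .C (Fintype.card V) + 1) + .C (Fintype.card V) + 2) + 1)

theorem eval_timeBound (n : ℕ) : (timeBound V).eval n =
    (n + 1) + (n + 1) + (n * (2 * n + 3) + 1) + 1 + ((pairSets V).length *
      ((n + Fintype.card V) * (n + Fintype.card V + 1) + Fintype.card V + 2) + 1) := by
  simp [timeBound]

/-- The run is timed in the number of vertices, whereas the bound is required in the length of the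
input, which is at least as large. -/
theorem eval_timeBound_mono {m n : ℕ} (h : m ≤ n) :
    (timeBound V).eval m ≤ (timeBound V).eval n := by
  rw [eval_timeBound, eval_timeBound]
  gcongr

theorem init_machine (w : List (Symb V)) :
    (machine H).init w = (⟨some .readPins, cleanState none (fun _ => false) (fun _ _ => false) 0,
      tapes w [] [] [] [] fun _ => []⟩ : Conf V) := by
  have : Function.update (fun _ => []) Tape.input (w.map id) = tapes w [] [] [] [] fun _ => [] := by
    funext t
    cases t <;> simp [Function.update, tapes]
  exact congrArg (fun T => (⟨some .readPins, cleanState none (fun _ => false) (fun _ _ => false) 0,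
    T⟩ : Conf V)) this

theorem machine_outputsWithin (hH : InvolutionFree H) (hO : (homsTo H).IsOracle O)
    (J : PartLabGraph V) :
    (machine H).OutputsWithin O J.encode (Nat.card (J.Homs H) : ZMod 2)
      ((timeBound V).eval J.encode.length) := by
  obtain ⟨cont, t, ht, hr⟩ := runs_blocks (H := H) (O := O) J (pairSets V) (Finset.nodup_toList _)
    (by simp [actions]) 0 (finalOut J H) (fun _ _ _ => rfl)
  have h := (runs_reading (H := H) (O := O) J).trans hr
  have hn : J.n ≤ J.encode.length := by
    simp [PartLabGraph.encode]
  refine ⟨(⟨none, cleanState none (fun _ => false) (pinAdj J)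
    (0 + ((pairSets V).map (contribution H O J)).sum), tapes [] [] (pinTable J) [] [] cont⟩ : Conf V),
    rfl, ?_, ⟨⟨J.n + 1 + (J.n + 1) + (J.n * (2 * J.n + 3) + 1) + 1 + t, ?_⟩, ?_⟩⟩
  · show (0 : ZMod 2) + _ = _
    rw [zero_add, sum_contribution hH hO]
  · rw [init_machine]
    exact h
  · refine le_trans ?_ (eval_timeBound_mono hn)
    rw [eval_timeBound]
    exact Nat.add_le_add_left ht _

end Assembly

end ParityHom

theorem mainTheorem4 {V : Type} [Finite V] (H : SimpleGraph V)
    (hH : ParityHom.InvolutionFree H) :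
    ParityHom.PolyTimeTuringReducible (ParityHom.partLabHomsTo H) (ParityHom.homsTo H) := by
  have : Fintype V := Fintype.ofFinite V
  exact ⟨ParityHom.machine H, ParityHom.timeBound V, fun _ hO J =>
    ParityHom.machine_outputsWithin hH hO J⟩
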